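/- Let $K$ be an algebraically closed field of characteristic $0$ and let $\mathbb{A}^n=K^n$ with the Zariski topology. For an irreducible affine variety $V\subseteq\mathbb{A}^n$ with ideal $I(V)\subseteq K[x_1,\dots,x_n]$ and dimension $d$ (the Krull dimension of $K[x_1,\dots,x_n]/I(V)$), the geometric degree $\deg(V)$ is the maximal cardinality of a finite intersection $V\cap L$, where $L\subseteq\mathbb{A}^n$ ranges over the affine linear subspaces of dimension $n-d$ (it is also the cardinality of $V\cap L$ for almost all such $L$). $V$ is smooth if its local ring at each of its points is a regular local ring, and it is a hypersurface if it is the zero set of a single nonconstant polynomial. The tangent bundle of a smooth variety $V$ is $$TV=\Big\{(x,y)\in\mathbb{A}^{2n}\ \Big|\ x\in V,\ \sum_{i=1}^n\frac{\partial f}{\partial x_i}(x)\,y_i=0\ \text{ for all } f\in I(V)\Big\}.$$ (1) For every $n$ and every smooth irreducible hypersurface $V\subseteq\mathbb{A}^n$, $\deg(V)$ is finite and $$\deg(TV)\le(\deg(V))^2 .$$ (2) This bound is optimal: for all integers $n,m\ge1$ with $n\ge2$ or $m=1$, there exists a smooth irreducible hypersurface $V\subseteq\mathbb{A}^n$ such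 that $\deg(V)=m$ and $\deg(TV)=m^2$. -/

import Mathlib

open MvPolynomial

noncomputable section

namespace AffineVariety

variable {K : Type*} [Field K] {σ : Type*}

/-- A Zariski closed subset of the affine space `K ^ σ`: the set of common zeros of some set of
polynomials (equivalently of the ideal it generates). -/
def IsAlgebraicSet (V : Set (σ → K)) : Prop :=
  ∃ I : Ideal (MvPolynomial σ K), V = zeroLocus K I

/-- An irreducible affine variety: a nonempty Zariski closed set that is not covered by two
Zariski closed sets unless one of them already contains it. -/
def IsIrreducibleVariety (V : Set (σ → K)) : Prop :=
  IsAlgebraicSet V ∧ V.Nonempty ∧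
    ∀ A B : Set (σ → K), IsAlgebraicSet A → IsAlgebraicSet B → V ⊆ A ∪ B → V ⊆ A ∨ V ⊆ B

/-- A hypersurface: the zero set of a single nonconstant polynomial. -/
def IsHypersurface (V : Set (σ → K)) : Prop :=
  ∃ F : MvPolynomial σ K, 0 < F.totalDegree ∧ V = {x | aeval x F = 0}

/-- The coordinate ring `K[V] = K[x] / I(V)`. -/
abbrev CoordinateRing (V : Set (σ → K)) : Type _ :=
  MvPolynomial σ K ⧸ vanishingIdeal K V

/-- Evaluation of regular functions at a point `p` of `V`. -/
def evalAt (V : Set (σ → K)) (p : V) : CoordinateRing V →+* K :=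
  Ideal.Quotient.lift (vanishingIdeal K V)
    (aeval (R := K) (p : σ → K) : MvPolynomial σ K →ₐ[K] K).toRingHom (fun _ hf => hf p p.2)

/-- The maximal ideal of the coordinate ring attached to a point `p` of `V`. -/
def pointIdeal (V : Set (σ → K)) (p : V) : Ideal (CoordinateRing V) :=
  RingHom.ker (evalAt V p)

instance pointIdeal_isPrime (V : Set (σ → K)) (p : V) : (pointIdeal V p).IsPrime :=
  RingHom.ker_isPrime (evalAt V p)

/-- The local ring `𝒪_p` of `V` at `p`. -/
abbrev LocalRingAt (V : Set (σ → K)) (p : V) : Type _ :=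
  Localization.AtPrime (pointIdeal V p)

/-- `V` is smooth if its local ring at each of its points is a regular local ring. -/
def IsSmoothVariety (V : Set (σ → K)) : Prop :=
  ∀ p : V, IsRegularLocalRing (LocalRingAt V p)

/-- The dimension of `V`: the Krull dimension of its coordinate ring. -/
def dimension (V : Set (σ → K)) : WithBot ℕ∞ :=
  ringKrullDim (CoordinateRing V)

/-- The geometric degree of an irreducible affine variety `V` of dimension `d` in the affine space
of dimension `N`: the supremum of the cardinalities of the finite sets `V ∩ L`, where `L` runs
over the affine linear subspaces of dimension `N - d`. -/
def geometricDegree [Fintype σ] (V : Set (σ → K)) : ℕ∞ :=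
  ⨆ (L : AffineSubspace K (σ → K)) (_ : (L : Set (σ → K)).Nonempty)
    (_ : (Module.finrank K L.direction : WithBot ℕ∞) + dimension V =
      (Fintype.card σ : WithBot ℕ∞))
    (_ : (V ∩ (L : Set (σ → K))).Finite), (V ∩ (L : Set (σ → K))).encard

/-- The tangent space of `V` at `p`: the common kernel of the differentials at `p` of the
polynomials in `I(V)`. -/
def tangentSpace [Fintype σ] (V : Set (σ → K)) (p : σ → K) : Set (σ → K) :=
  {y | ∀ f ∈ vanishingIdeal K V, ∑ i, aeval p (pderiv i f) * y i = 0}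

/-- The tangent bundle `TV = {(x, y) | x ∈ V, y ∈ T_x V}`, a subset of the affine space of twice
the dimension; the coordinates `Sum.inl i` are those of `x`, the coordinates `Sum.inr i` those
of `y`. -/
def tangentBundle [Fintype σ] (V : Set (σ → K)) : Set (σ ⊕ σ → K) :=
  {z | (fun i => z (Sum.inl i)) ∈ V ∧
    (fun i => z (Sum.inr i)) ∈ tangentSpace V (fun i => z (Sum.inl i))}

end AffineVariety

end

/-! By unique factorization and the Nullstellensatz, an irreducible hypersurface is `V = Z(F)` with
`F` irreducible and `I(V) = (F)`. Put `m = deg F`.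

The degree of `V` is `m`. A line turns `F` into a one-variable polynomial of degree at most `m`. In
a direction where the leading form of `F` is nonzero the degree is exactly `m`, and in
characteristic `0` some parallel line makes the restriction separable, giving `m` distinct points
(`geometricDegree_hypersurface`).

The tangent bundle is cut out by just two equations, `F(x) = 0` and `dF(x, y) = 0`, each of degree
at most `m` (`tangentBundle_eq`). Since `F` is prime and does not divide `dF`, its codimension is
exactly `2` (`dimension_tangentBundle`), so its degree is measured on planes. There the two
equations become plane curves of degree at most `m`, and a finite intersection has at most `m ^ 2`
points by Bézout (`encard_le_sq_of_finite`).

For sharpness with `n ≥ 2`, take the cylinder `x₀ ^ m + x₁ ^ m = 1`: on the plane `y₀ = x₀`, `y₁ =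
-x₁` the two equations say `x₀ ^ m = x₁ ^ m = 1 / 2`, which has `m ^ 2` solutions. For `n = 1`, `m =
1` a point suffices. -/

noncomputable section

namespace AffineVariety

/-! ### Dimension bounds for zero sets in affine space -/

section Dimension

variable {K : Type*} [Field K] {σ : Type*}

/-- The translation `x ↦ x + p` of affine space, acting on polynomials. -/
def translate (p : σ → K) : MvPolynomial σ K ≃ₐ[K] MvPolynomial σ K :=
  AlgEquiv.ofAlgHom (aeval fun i => X i + C (p i)) (aeval fun i => X i - C (p i))
    (by ext i; simp [algHom_C]) (by ext i; simp [algHom_C])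

lemma aeval_translate (p x : σ → K) (f : MvPolynomial σ K) :
    aeval x (translate p f) = aeval (x + p) f := by
  have : (aeval x : MvPolynomial σ K →ₐ[K] K).comp (translate p).toAlgHom = aeval (x + p) := by
    ext i; simp [translate]
  exact DFunLike.congr_fun this f

lemma comap_translate_vanishingIdeal (p : σ → K) :
    (vanishingIdeal K {(0 : σ → K)}).comap (translate p).toRingEquiv = vanishingIdeal K {p} := by
  ext f
  simp only [Ideal.mem_comap, mem_vanishingIdeal_singleton_iff]
  change aeval 0 (translate p f) = 0 ↔ _
  rw [aeval_translate, zero_add]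

lemma height_vanishingIdeal_singleton_eq (p : σ → K) :
    (vanishingIdeal K {p}).height = (vanishingIdeal K {(0 : σ → K)}).height := by
  rw [← comap_translate_vanishingIdeal p, RingEquiv.height_comap]

variable [Fintype σ]

/-- Every maximal ideal is the ideal of a point, and translations identify all of these. Their
common height is therefore the Krull dimension of the polynomial ring. -/
lemma height_vanishingIdeal_singleton [IsAlgClosed K] (p : σ → K) :
    (vanishingIdeal K {p}).height = Fintype.card σ := by
  have h0 : ringKrullDim (MvPolynomial σ K) = (Fintype.card σ : ℕ∞) := by
    simp
  have h1 : ringKrullDim (MvPolynomial σ K) = ((vanishingIdeal K {p}).height : WithBot ℕ∞) := by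
    refine le_antisymm ?_ (Ideal.height_le_ringKrullDim_of_ne_top Ideal.IsPrime.ne_top')
    rw [ringKrullDim_le_iff_isMaximal_height_le]
    intro M hM
    obtain ⟨x, rfl⟩ := isMaximal_iff_eq_vanishingIdeal_singleton.1 hM
    rw [height_vanishingIdeal_singleton_eq, height_vanishingIdeal_singleton_eq p]
  rw [h0] at h1
  exact_mod_cast h1.symm

lemma ringKrullDim_quotient_radical {R : Type*} [CommRing R] (I : Ideal R) :
    ringKrullDim (R ⧸ I.radical) = ringKrullDim (R ⧸ I) := by
  rw [ringKrullDim_quotient, ringKrullDim_quotient, PrimeSpectrum.zeroLocus_radical]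

/-- A nonempty set defined by `s.encard` equations has codimension at most `s.encard`. -/
lemma card_le_dimension_add_encard [IsAlgClosed K] (s : Set (MvPolynomial σ K))
    (h : (zeroLocus K (Ideal.span s)).Nonempty) :
    ((Fintype.card σ : ℕ∞) : WithBot ℕ∞) ≤
      dimension (zeroLocus K (Ideal.span s)) + s.encard := by
  obtain ⟨p, hp⟩ := h
  have hs : s ⊆ vanishingIdeal K {p} := fun f hf => by
    simpa using hp f (Ideal.subset_span hf)
  -- Krull's height theorem at a point of the zero set; passing from the ideal to its radical does
  -- not change the dimension of the quotient.
  have := Ideal.height_le_ringKrullDim_quotient_add_encard s hs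
  rwa [height_vanishingIdeal_singleton, ← ringKrullDim_quotient_radical,
    ← vanishingIdeal_zeroLocus_eq_radical (K := K)] at this

lemma dimension_add_one_le {V : Set (σ → K)} {f : MvPolynomial σ K} (hf : f ≠ 0)
    (hV : f ∈ vanishingIdeal K V) :
    dimension V + 1 ≤ (Fintype.card σ : ℕ∞) := by
  have := ringKrullDim_succ_le_of_surjective (Ideal.Quotient.mk (vanishingIdeal K V))
    Ideal.Quotient.mk_surjective (mem_nonZeroDivisors_of_ne_zero hf)
    (Ideal.Quotient.eq_zero_iff_mem.2 hV)
  simpa [dimension] using this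

/-- The dimension drops modulo `f`, and drops again modulo `g`, which is a nonzerodivisor in the
domain `K[x] / (f)`. -/
lemma dimension_add_two_le {V : Set (σ → K)} {f g : MvPolynomial σ K} (hf : Prime f)
    (hg : ¬ f ∣ g) (hfV : f ∈ vanishingIdeal K V) (hgV : g ∈ vanishingIdeal K V) :
    dimension V + 1 + 1 ≤ (Fintype.card σ : ℕ∞) := by
  have hP := (Ideal.span_singleton_prime hf.ne_zero).2 hf
  have hle : Ideal.span {f} ≤ vanishingIdeal K V := by
    rwa [Ideal.span_singleton_le_iff_mem]
  have h1 : ringKrullDim (MvPolynomial σ K ⧸ Ideal.span {f}) + 1 ≤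
      ringKrullDim (MvPolynomial σ K) :=
    ringKrullDim_quotient_succ_le_of_nonZeroDivisor (mem_nonZeroDivisors_of_ne_zero hf.ne_zero)
  have h2 : ringKrullDim (MvPolynomial σ K ⧸ vanishingIdeal K V) + 1 ≤
      ringKrullDim (MvPolynomial σ K ⧸ Ideal.span {f}) := by
    refine ringKrullDim_succ_le_of_surjective (Ideal.Quotient.factor hle)
      (Ideal.Quotient.factor_surjective hle)
      (r := Ideal.Quotient.mk _ g) (mem_nonZeroDivisors_of_ne_zero ?_) ?_
    · rwa [Ne, Ideal.Quotient.eq_zero_iff_mem, Ideal.mem_span_singleton]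
    · simpa [Ideal.Quotient.eq_zero_iff_mem] using hgV
  have h3 : ringKrullDim (MvPolynomial σ K) = (Fintype.card σ : ℕ∞) := by simp
  rw [← h3]
  exact le_trans (by gcongr; exact h2) h1

end Dimension

/-! ### Irreducible hypersurfaces and their equations -/

section Hypersurface

variable {K : Type*} [Field K] {σ : Type*}

lemma mem_zeroLocus_span_singleton {F : MvPolynomial σ K} {x : σ → K} :
    x ∈ zeroLocus K (Ideal.span {F}) ↔ aeval x F = 0 := by
  rw [zeroLocus_span]; simp

lemma mem_zeroLocus_span_pair {F G : MvPolynomial σ K} {x : σ → K} :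
    x ∈ zeroLocus K (Ideal.span {F, G}) ↔ aeval x F = 0 ∧ aeval x G = 0 := by
  rw [zeroLocus_span]; simp

lemma IsIrreducibleVariety.isPrime {V : Set (σ → K)} (hV : IsIrreducibleVariety V) :
    (vanishingIdeal K V).IsPrime := by
  obtain ⟨-, ⟨p, hp⟩, h⟩ := hV
  refine Ideal.isPrime_iff.2 ⟨fun ht => ?_, fun {f g} hfg => ?_⟩
  · have : (1 : MvPolynomial σ K) ∈ vanishingIdeal K V := ht ▸ Submodule.mem_top
    simpa using this p hp
  · refine (h _ _ ⟨Ideal.span {f}, rfl⟩ ⟨Ideal.span {g}, rfl⟩ fun x hx => ?_).imp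
      (fun h x hx => mem_zeroLocus_span_singleton.1 (h hx))
      (fun h x hx => mem_zeroLocus_span_singleton.1 (h hx))
    have := hfg x hx
    rw [map_mul, mul_eq_zero] at this
    exact this.imp mem_zeroLocus_span_singleton.2 mem_zeroLocus_span_singleton.2

lemma isIrreducibleVariety_of_isPrime {V : Set (σ → K)} (hV : IsAlgebraicSet V)
    (hP : (vanishingIdeal K V).IsPrime) : IsIrreducibleVariety V := by
  refine ⟨hV, ?_, ?_⟩
  · by_contra h
    rw [Set.not_nonempty_iff_eq_empty] at h
    exact hP.ne_top (h ▸ vanishingIdeal_empty)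
  · rintro A B ⟨I, rfl⟩ ⟨J, rfl⟩ h
    by_contra! hAB
    obtain ⟨⟨a, ha, ha'⟩, ⟨b, hb, hb'⟩⟩ :=
      And.intro (Set.not_subset.1 hAB.1) (Set.not_subset.1 hAB.2)
    simp only [mem_zeroLocus_iff, not_forall] at ha' hb'
    obtain ⟨f, hf, hfa⟩ := ha'
    obtain ⟨g, hg, hgb⟩ := hb'
    have : f * g ∈ vanishingIdeal K V := fun x hx => by
      rcases h hx with hx | hx
      · rw [map_mul, hx f hf, zero_mul]
      · rw [map_mul, hx g hg, mul_zero]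
    rcases hP.mem_or_mem this with h | h
    · exact hfa (h a ha)
    · exact hgb (h b hb)

lemma vanishingIdeal_zeroLocus_of_irreducible [Finite σ] [IsAlgClosed K]
    {F : MvPolynomial σ K} (hF : Irreducible F) :
    vanishingIdeal K (zeroLocus K (Ideal.span {F})) = Ideal.span {F} :=
  have := (Ideal.span_singleton_prime hF.ne_zero).2 hF.prime
  IsPrime.vanishingIdeal_zeroLocus _

/-- Since `I(V)` is prime it contains an irreducible factor `f` of the given equation `F`; then `V ⊆
Z(f) ⊆ Z(F) = V`. -/
lemma exists_irreducible_of_isHypersurface {V : Set (σ → K)} (hV : IsIrreducibleVariety V)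
    (h : IsHypersurface V) :
    ∃ F : MvPolynomial σ K, Irreducible F ∧ V = zeroLocus K (Ideal.span {F}) := by
  obtain ⟨F, hdeg, hVF⟩ := h
  have hP := hV.isPrime
  have hF : F ∈ vanishingIdeal K V := fun x hx => by rw [hVF] at hx; exact hx
  have hF0 : F ≠ 0 := by rintro rfl; simp at hdeg
  obtain ⟨u, hu⟩ := (UniqueFactorizationMonoid.factors_prod hF0).symm
  have hmem : (UniqueFactorizationMonoid.factors F).prod ∈ vanishingIdeal K V := by
    rw [← hu]; exact Ideal.mul_mem_right _ _ hF
  obtain ⟨f, hf, hfV⟩ := (hP.multiset_prod_mem_iff_exists_mem _).1 hmem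
  refine ⟨f, UniqueFactorizationMonoid.irreducible_of_factor f hf, Set.Subset.antisymm
    (fun x hx => mem_zeroLocus_span_singleton.2 (hfV x hx)) fun x hx => ?_⟩
  obtain ⟨g, rfl⟩ := UniqueFactorizationMonoid.dvd_of_mem_factors hf
  rw [hVF, Set.mem_ofPred_eq, map_mul, mem_zeroLocus_span_singleton.1 hx, zero_mul]

lemma totalDegree_pos_of_irreducible {F : MvPolynomial σ K} (hF : Irreducible F) :
    0 < F.totalDegree := by
  rw [Nat.pos_iff_ne_zero]
  intro h
  rw [totalDegree_eq_zero_iff_eq_C] at h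
  apply hF.not_isUnit
  rw [h]
  refine (IsUnit.mk0 _ fun h0 => hF.ne_zero ?_).map C
  rw [h, h0, C_0]

lemma isIrreducibleVariety_of_irreducible [Finite σ] [IsAlgClosed K]
    {F : MvPolynomial σ K} (hF : Irreducible F) :
    IsIrreducibleVariety (zeroLocus K (Ideal.span {F})) :=
  isIrreducibleVariety_of_isPrime ⟨_, rfl⟩ <| by
    rw [vanishingIdeal_zeroLocus_of_irreducible hF]
    exact (Ideal.span_singleton_prime hF.ne_zero).2 hF.prime

lemma isHypersurface_of_irreducible {F : MvPolynomial σ K} (hF : Irreducible F) :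
    IsHypersurface (zeroLocus K (Ideal.span {F})) :=
  ⟨F, totalDegree_pos_of_irreducible hF, Set.ext fun _ => mem_zeroLocus_span_singleton⟩

end Hypersurface

/-! ### Equations and dimension of the tangent bundle -/

section TangentBundle

variable {K : Type*} [Field K] {σ : Type*}

/-- The differential `∑ ∂F/∂xᵢ yᵢ` of `F`, a polynomial in the variables `x` and `y`. -/
def differential [Fintype σ] (F : MvPolynomial σ K) : MvPolynomial (σ ⊕ σ) K :=
  ∑ i, rename Sum.inl (pderiv i F) * X (Sum.inr i)

lemma aeval_differential [Fintype σ] (F : MvPolynomial σ K) (z : σ ⊕ σ → K) :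
    aeval z (differential F) =
      ∑ i, aeval (fun j => z (Sum.inl j)) (pderiv i F) * z (Sum.inr i) := by
  simp only [differential, map_sum, map_mul, aeval_rename, aeval_X, Function.comp_def]

/-- At a zero of `F` the product rule gives `d(F g) = g dF`, so the generator of `I(V)` alone
determines the tangent space. -/
lemma tangentBundle_eq [Fintype σ] [IsAlgClosed K] {F : MvPolynomial σ K} (hF : Irreducible F) :
    tangentBundle (zeroLocus K (Ideal.span {F})) =
      zeroLocus K (Ideal.span {rename Sum.inl F, differential F}) := by
  ext z
  rw [mem_zeroLocus_span_pair, aeval_differential, aeval_rename]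
  simp only [tangentBundle, Set.mem_ofPred_eq, mem_zeroLocus_span_singleton, tangentSpace,
    vanishingIdeal_zeroLocus_of_irreducible hF]
  refine and_congr_right fun hx => ⟨fun h => h F (Ideal.mem_span_singleton_self F), ?_⟩
  intro h f hf
  obtain ⟨g, rfl⟩ := Ideal.mem_span_singleton.1 hf
  simp only [pderiv_mul, map_add, map_mul, hx, zero_mul, add_zero]
  rw [← zero_mul (aeval (fun i => z (Sum.inl i)) g), ← h, Finset.sum_mul]
  exact Finset.sum_congr rfl fun i _ => by simp; ring

lemma totalDegree_pderiv_le (F : MvPolynomial σ K) (i : σ) :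
    (pderiv i F).totalDegree ≤ F.totalDegree - 1 := by
  refine Finset.sup_le fun m hm => ?_
  rw [mem_support_iff, coeff_pderiv] at hm
  have := le_totalDegree (mem_support_iff.2 (left_ne_zero_of_mul hm))
  rw [Finsupp.sum_add_index' (by simp) (by simp)] at this
  simp only [Finsupp.sum_single_index] at this
  omega

lemma exists_pderiv_ne_zero [CharZero K] {F : MvPolynomial σ K} (hF : 0 < F.totalDegree) :
    ∃ i, pderiv i F ≠ 0 := by
  by_contra! h
  refine hF.ne' (totalDegree_eq_zero_iff_eq_C.2 ?_)
  ext m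
  classical
  rw [coeff_C]
  split_ifs with hm
  · rw [hm]
  · obtain ⟨i, hi⟩ : ∃ i, m i ≠ 0 := by
      by_contra! h0
      exact hm (Finsupp.ext fun i => (h0 i).symm)
    have := coeff_pderiv (i := i) F (m - Finsupp.single i 1)
    have hle : Finsupp.single i 1 ≤ m := by
      rw [Finsupp.single_le_iff]; omega
    rw [h i, coeff_zero, tsub_add_cancel_of_le hle] at this
    refine (mul_eq_zero.1 this.symm).resolve_right ?_
    exact Nat.cast_add_one_ne_zero _

/-- Substituting the `i`-th basis vector for `y` would make `F` divide `∂F/∂xᵢ`. In characteristic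
`0` some such derivative is nonzero, and its degree is too small. -/
lemma not_dvd_differential [Fintype σ] [CharZero K] {F : MvPolynomial σ K}
    (hF : 0 < F.totalDegree) : ¬ rename Sum.inl F ∣ differential F := by
  classical
  intro h
  obtain ⟨i, hi⟩ := exists_pderiv_ne_zero hF
  have := map_dvd (aeval (Sum.elim X (fun j => if j = i then 1 else 0)) :
    MvPolynomial (σ ⊕ σ) K →ₐ[K] MvPolynomial σ K) h
  simp only [aeval_rename, Sum.elim_comp_inl, differential, map_sum, map_mul, aeval_X,
    Sum.elim_inr, mul_ite, mul_one, mul_zero, Finset.sum_ite_eq', Finset.mem_univ, if_true,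
    aeval_X_left, AlgHom.id_apply] at this
  have h1 := totalDegree_pderiv_le F i
  have h2 := totalDegree_le_of_dvd_of_isDomain this hi
  omega

/-- As a polynomial in the second group of variables over `K[x]`, the renamed `F` is a constant, and
constants inherit primality. -/
lemma prime_rename_inl {τ : Type*} {F : MvPolynomial σ K} (hF : Prime F) :
    Prime (rename (Sum.inl : σ → σ ⊕ τ) F) := by
  rw [← MulEquiv.prime_iff ((renameEquiv K (Equiv.sumComm σ τ)).trans (sumAlgEquiv K τ σ))]
  have : ((renameEquiv K (Equiv.sumComm σ τ)).trans (sumAlgEquiv K τ σ))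
      (rename (Sum.inl : σ → σ ⊕ τ) F) = C F := by
    have := DFunLike.congr_fun (sumAlgEquiv_comp_rename_inr (R := K) (S₁ := τ) (S₂ := σ)) F
    simp only [AlgEquiv.trans_apply, renameEquiv_apply, rename_rename]
    exact this
  rw [this]
  exact (prime_C_iff τ).2 hF

lemma dimension_hypersurface [Fintype σ] [IsAlgClosed K] {F : MvPolynomial σ K}
    (hF : Irreducible F) :
    dimension (zeroLocus K (Ideal.span {F})) + 1 = (Fintype.card σ : ℕ∞) := by
  refine le_antisymm (dimension_add_one_le hF.ne_zero ?_) ?_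
  · exact fun x hx => mem_zeroLocus_span_singleton.1 hx
  · simpa using card_le_dimension_add_encard {F} (isIrreducibleVariety_of_irreducible hF).2.1

lemma dimension_tangentBundle [Fintype σ] [IsAlgClosed K] [CharZero K] {F : MvPolynomial σ K}
    (hF : Irreducible F) :
    dimension (tangentBundle (zeroLocus K (Ideal.span {F}))) + 2 =
      (Fintype.card (σ ⊕ σ) : ℕ∞) := by
  have h2 : (2 : WithBot ℕ∞) = 1 + 1 := by norm_num
  refine le_antisymm ?_ ?_
  · rw [h2, ← add_assoc, tangentBundle_eq hF]
    exact dimension_add_two_le (prime_rename_inl hF.prime)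
      (not_dvd_differential (totalDegree_pos_of_irreducible hF))
      (fun x hx => (mem_zeroLocus_span_pair.1 hx).1) (fun x hx => (mem_zeroLocus_span_pair.1 hx).2)
  · obtain ⟨p, hp⟩ := (isIrreducibleVariety_of_irreducible hF).2.1
    -- Krull's bound needs a point: the zero tangent vector at `p`.
    have h0 : (tangentBundle (zeroLocus K (Ideal.span {F}))).Nonempty :=
      ⟨Sum.elim p 0, by simpa using hp, fun f hf => by simp⟩
    rw [tangentBundle_eq hF] at h0 ⊢
    refine (card_le_dimension_add_encard _ h0).trans ?_
    gcongr
    have h3 : ({rename Sum.inl F, differential F} : Set (MvPolynomial (σ ⊕ σ) K)).encard ≤ 2 := by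
      simpa [one_add_one_eq_two] using
        Set.encard_insert_le {differential F} (rename (Sum.inl : σ → σ ⊕ σ) F)
    exact WithBot.coe_le_coe.2 h3

end TangentBundle

/-! ### Restriction of a polynomial to a line -/

section Line

variable {K : Type*} [Field K] {σ : Type*} {A : Type*} [CommRing A] [Algebra K A]

/-- The restriction `F (p + t v)` of `F` to a parametrized line, a polynomial in `t`. -/
def lineRestriction (p v : σ → A) : MvPolynomial σ K →ₐ[K] Polynomial A :=
  aeval fun i => Polynomial.C (p i) + Polynomial.C (v i) * Polynomial.X

lemma coeff_prod_sum_of_natDegree_le {ι R : Type*} [CommSemiring R] (s : Finset ι)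
    (f : ι → Polynomial R) (d : ι → ℕ) (h : ∀ i, (f i).natDegree ≤ d i) :
    (∏ i ∈ s, f i).coeff (∑ i ∈ s, d i) = ∏ i ∈ s, (f i).coeff (d i) := by
  classical
  induction s using Finset.induction_on with
  | empty => simp
  | insert a s ha ih =>
    rw [Finset.prod_insert ha, Finset.sum_insert ha, Finset.prod_insert ha,
      Polynomial.coeff_mul_add_eq_of_natDegree_le (h a), ih]
    exact (Polynomial.natDegree_prod_le _ _).trans (Finset.sum_le_sum fun i _ => h i)

lemma lineRestriction_monomial (p v : σ → A) (d : σ →₀ ℕ) {m : ℕ} (hd : d.degree = m) :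
    (∏ i ∈ d.support, (Polynomial.C (p i) + Polynomial.C (v i) * Polynomial.X) ^ d i).natDegree
      ≤ m ∧
    (∏ i ∈ d.support,
      (Polynomial.C (p i) + Polynomial.C (v i) * Polynomial.X) ^ d i).coeff m =
      ∏ i ∈ d.support, v i ^ d i := by
  have h1 : ∀ i, (Polynomial.C (p i) + Polynomial.C (v i) * Polynomial.X).natDegree ≤ 1 :=
    fun i => by compute_degree
  have h2 : ∀ i, ((Polynomial.C (p i) + Polynomial.C (v i) * Polynomial.X) ^ d i).natDegree
      ≤ d i := fun i => by simpa using Polynomial.natDegree_pow_le_of_le (d i) (h1 i)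
  subst hd
  rw [Finsupp.degree_apply]
  refine ⟨(Polynomial.natDegree_prod_le _ _).trans (Finset.sum_le_sum fun i _ => h2 i), ?_⟩
  rw [coeff_prod_sum_of_natDegree_le _ _ _ h2]
  refine Finset.prod_congr rfl fun i _ => ?_
  have := Polynomial.coeff_pow_of_natDegree_le (m := d i) (h1 i)
  simpa using this

lemma natDegree_lineRestriction_le (p v : σ → A) (F : MvPolynomial σ K) :
    (lineRestriction p v F).natDegree ≤ F.totalDegree := by
  rw [lineRestriction, aeval_def, eval₂_eq]
  refine Polynomial.natDegree_sum_le_of_forall_le _ _ fun d hd => ?_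
  rw [Polynomial.algebraMap_apply]
  refine (Polynomial.natDegree_C_mul_le _ _).trans ?_
  refine (lineRestriction_monomial p v d rfl).1.trans ?_
  exact le_totalDegree hd

/-- The top coefficient does not depend on `p`: if the leading form is nonzero at `v`, the
restrictions to all lines of direction `v` have full degree. -/
lemma coeff_lineRestriction (p v : σ → A) (F : MvPolynomial σ K) :
    (lineRestriction p v F).coeff F.totalDegree =
      aeval v (homogeneousComponent F.totalDegree F) := by
  rw [lineRestriction, aeval_def, eval₂_eq, homogeneousComponent_apply, map_sum,
    Finset.sum_filter, Polynomial.finsetSum_coeff]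
  refine Finset.sum_congr rfl fun d hd => ?_
  rw [Polynomial.algebraMap_apply, Polynomial.coeff_C_mul]
  split_ifs with h
  · rw [(lineRestriction_monomial p v d h).2, aeval_monomial]
    rfl
  · rw [Polynomial.coeff_eq_zero_of_natDegree_lt, mul_zero]
    refine (lineRestriction_monomial p v d rfl).1.trans_lt ?_
    exact lt_of_le_of_ne (le_totalDegree hd) h

lemma eval_lineRestriction (p v : σ → A) (t : A) (F : MvPolynomial σ K) :
    (lineRestriction p v F).eval t = aeval (fun i => p i + v i * t) F := by
  have : ((Polynomial.aeval t).restrictScalars K).comp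
      (lineRestriction p v : MvPolynomial σ K →ₐ[K] Polynomial A) =
      aeval fun i => p i + v i * t := by
    ext i; simp [lineRestriction]
  simpa using DFunLike.congr_fun this F

lemma exists_aeval_homogeneousComponent_ne_zero [Infinite K] {F : MvPolynomial σ K}
    (hF : F ≠ 0) : ∃ v : σ → K, aeval v (homogeneousComponent F.totalDegree F) ≠ 0 := by
  by_contra! h
  have h0 : homogeneousComponent F.totalDegree F = 0 := funext fun v => by
    simpa using h v
  obtain ⟨d, hd, hd'⟩ := F.support.exists_mem_eq_sup (support_nonempty.2 hF)
    (fun s => s.sum fun _ e => e)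
  have := congrArg (coeff d) h0
  rw [coeff_homogeneousComponent, if_pos, coeff_zero] at this
  · exact mem_support_iff.1 hd this
  · rw [totalDegree, hd']; rfl

end Line

/-! ### Bézout's bound for plane curves -/

section PlaneCurves

variable {K : Type*} [Field K]

/-- Every line in a direction `v` off the leading form meets the curve. These parallel lines are the
level sets of `v₁ x₀ - v₀ x₁`, which therefore takes every value on the curve. -/
lemma infinite_zeros_of_totalDegree_pos [IsAlgClosed K] {h : MvPolynomial (Fin 2) K}
    (hh : 0 < h.totalDegree) : {x : Fin 2 → K | aeval x h = 0}.Infinite := by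
  have := IsAlgClosed.instInfinite (K := K)
  have hh0 : h ≠ 0 := by rintro rfl; simp at hh
  obtain ⟨v, hv⟩ := exists_aeval_homogeneousComponent_ne_zero hh0
  have hroot : ∀ p : Fin 2 → K, ∃ t, aeval (fun i => p i + v i * t) h = 0 := by
    intro p
    have hc : (lineRestriction p v h).coeff h.totalDegree ≠ 0 := by
      rwa [coeff_lineRestriction]
    have hdeg := Polynomial.le_natDegree_of_ne_zero hc
    obtain ⟨t, ht⟩ := IsAlgClosed.exists_root (lineRestriction p v h)
      (Polynomial.natDegree_pos_iff_degree_pos.1 (by omega)).ne'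
    exact ⟨t, by rw [← eval_lineRestriction]; exact ht⟩
  have hv0 : v 0 ≠ 0 ∨ v 1 ≠ 0 := by
    by_contra! h0
    have hv' : v = 0 := by ext i; fin_cases i <;> simp [h0]
    refine hv ?_
    rw [hv', aeval_zero, constantCoeff_eq, coeff_homogeneousComponent, if_neg]
    · simp
    · simpa using hh.ne
  refine Set.Infinite.of_image (fun x : Fin 2 → K => v 1 * x 0 - v 0 * x 1) ?_
  convert Set.infinite_univ (α := K)
  refine Set.eq_univ_of_forall fun s => ?_
  rcases hv0 with h0 | h0
  · obtain ⟨t, ht⟩ := hroot ![0, - s / v 0]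
    refine ⟨_, ht, ?_⟩
    simp
    field_simp
    ring
  · obtain ⟨t, ht⟩ := hroot ![s / v 1, 0]
    refine ⟨_, ht, ?_⟩
    simp
    field_simp
    ring

lemma two_mul_finrank_restrictTotalDegree (d : ℕ) :
    2 * Module.finrank K (restrictTotalDegree (Fin 2) K d) = (d + 1) * (d + 2) := by
  rw [restrictTotalDegree, Module.finrank_eq_nat_card_basis (basisRestrictSupport K _)]
  let e : {n : Fin 2 →₀ ℕ | (n.sum fun _ e => e) ≤ d} ≃
      (Finset.range (d + 1)).sigma (fun k => Finset.HasAntidiagonal.antidiagonal k) :=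
    { toFun := fun n => ⟨⟨n.1 0 + n.1 1, (n.1 0, n.1 1)⟩, by
        have := n.2
        simp [Finsupp.sum_fintype] at this ⊢
        omega⟩
      invFun := fun x => ⟨Finsupp.equivFunOnFinite.symm ![x.1.2.1, x.1.2.2], by
        have := Finset.mem_sigma.1 x.2
        rw [Finset.mem_range, Finset.HasAntidiagonal.mem_antidiagonal] at this
        simp [Finsupp.sum_fintype]
        omega⟩
      left_inv := fun n => by
        ext i; fin_cases i <;> simp
      right_inv := fun ⟨⟨k, a, b⟩, h⟩ => by
        simp at h ⊢
        obtain ⟨h1, rfl⟩ := h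
        simp }
  rw [Nat.card_congr e, Nat.card_eq_fintype_card, Fintype.card_coe, Finset.card_sigma]
  simp only [Finset.Nat.card_antidiagonal]
  induction d with
  | zero => simp
  | succ d ih =>
    rw [Finset.sum_range_succ, mul_add, ih]
    ring

lemma finiteDimensional_restrictTotalDegree (d : ℕ) :
    FiniteDimensional K (restrictTotalDegree (Fin 2) K d) := by
  refine Module.finite_of_finrank_pos ?_
  have := two_mul_finrank_restrictTotalDegree (K := K) d
  have h : 0 < (d + 1) * (d + 2) := by positivity
  omega

lemma finrank_map_mulLeft {g : MvPolynomial (Fin 2) K} (hg : g ≠ 0)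
    (W : Submodule K (MvPolynomial (Fin 2) K)) :
    Module.finrank K (W.map (LinearMap.mulLeft K g)) = Module.finrank K W :=
  (Submodule.equivMapOfInjective _ (mul_right_injective₀ hg) W).finrank_eq.symm

/-- A product of factors `xᵢ - aᵢ`, one for each `a ∈ S` other than `p`, with `i` a coordinate where
`a` and `p` differ. -/
lemma exists_separating_polynomial (S : Finset (Fin 2 → K)) (p : Fin 2 → K) :
    ∃ h : MvPolynomial (Fin 2) K, h.totalDegree ≤ S.card ∧ aeval p h ≠ 0 ∧
      ∀ q ∈ S, q ≠ p → aeval q h = 0 := by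
  classical
  induction S using Finset.induction_on with
  | empty => exact ⟨1, by simp, by simp, by simp⟩
  | insert a S ha ih =>
    obtain ⟨h, h1, h2, h3⟩ := ih
    by_cases hap : a = p
    · refine ⟨h, h1.trans (Finset.card_le_card (Finset.subset_insert _ _)), h2, ?_⟩
      intro q hq hqp
      rcases Finset.mem_insert.1 hq with rfl | hq
      · exact absurd hap hqp
      · exact h3 q hq hqp
    · obtain ⟨i, hi⟩ := Function.ne_iff.1 hap
      refine ⟨h * (X i - C (a i)), ?_, ?_, ?_⟩
      · rw [Finset.card_insert_of_notMem ha]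
        refine (totalDegree_mul _ _).trans (add_le_add h1 ?_)
        exact (totalDegree_sub_C_le _ _).trans (totalDegree_X i).le
      · rw [map_mul]
        refine mul_ne_zero h2 ?_
        simpa [sub_eq_zero] using Ne.symm hi
      · intro q hq hqp
        rw [map_mul]
        rcases Finset.mem_insert.1 hq with rfl | hq
        · simp
        · rw [h3 q hq hqp, zero_mul]

/-- Bézout's bound for the number of common zeros of two coprime plane curves. -/
lemma card_le_mul_of_isRelPrime {f g : MvPolynomial (Fin 2) K} (hf : f ≠ 0) (hg : g ≠ 0)
    (h : IsRelPrime f g) (S : Finset (Fin 2 → K))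
    (hS : ∀ p ∈ S, aeval p f = 0 ∧ aeval p g = 0) :
    S.card ≤ f.totalDegree * g.totalDegree := by
  classical
  set a := f.totalDegree with ha
  set b := g.totalDegree with hb
  set s := S.card with hs
  -- The count takes place in `W (a + b + s)`: polynomials vanishing on `S` have codimension `s`
  -- there and include `f W (b + s) + g W (a + s)`. The shift by `s` leaves room for the separating
  -- polynomials.
  let W : ℕ → Submodule K (MvPolynomial (Fin 2) K) := fun k => restrictTotalDegree (Fin 2) K k
  have hfin : ∀ k, FiniteDimensional K (W k) := finiteDimensional_restrictTotalDegree
  let U₁ := (W (b + s)).map (LinearMap.mulLeft K f)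
  let U₂ := (W (a + s)).map (LinearMap.mulLeft K g)
  let ev : MvPolynomial (Fin 2) K →ₗ[K] (S → K) :=
    LinearMap.pi fun p => (aeval p.1 : MvPolynomial (Fin 2) K →ₐ[K] K).toLinearMap
  have hU : U₁ ⊔ U₂ ≤ W (a + b + s) := by
    refine sup_le ?_ ?_ <;> rintro _ ⟨u, hu, rfl⟩ <;>
      rw [SetLike.mem_coe, mem_restrictTotalDegree] at hu <;>
      rw [mem_restrictTotalDegree] <;> refine (totalDegree_mul _ _).trans ?_ <;> omega
  have hker : U₁ ⊔ U₂ ≤ LinearMap.ker ev := by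
    refine sup_le ?_ ?_ <;> rintro _ ⟨u, hu, rfl⟩ <;> rw [LinearMap.mem_ker] <;> ext p
    · simp only [ev, LinearMap.mulLeft_apply, LinearMap.pi_apply, AlgHom.toLinearMap_apply,
        map_mul, (hS p.1 p.2).1, zero_mul, Pi.zero_apply]
    · simp only [ev, LinearMap.mulLeft_apply, LinearMap.pi_apply, AlgHom.toLinearMap_apply,
        map_mul, (hS p.1 p.2).2, zero_mul, Pi.zero_apply]
  -- By coprimality, a common multiple of `f` and `g` is a multiple of `f g`.
  have hinf : U₁ ⊓ U₂ ≤ (W s).map (LinearMap.mulLeft K (f * g)) := by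
    rintro _ ⟨⟨u, hu, rfl⟩, ⟨v, hv, huv⟩⟩
    simp only [LinearMap.mulLeft_apply] at huv
    obtain ⟨w, rfl⟩ : g ∣ u := h.symm.dvd_of_dvd_mul_left ⟨v, huv.symm⟩
    refine ⟨w, ?_, by simp⟩
    rw [SetLike.mem_coe, mem_restrictTotalDegree] at hu ⊢
    by_cases hw : w = 0
    · simp [hw]
    · rw [totalDegree_mul_of_isDomain hg hw] at hu
      omega
  have hsurj : LinearMap.range (ev.domRestrict (W (a + b + s))) = ⊤ := by
    rw [eq_top_iff, ← (Pi.basisFun K S).span_eq, Submodule.span_le]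
    rintro _ ⟨p, rfl⟩
    obtain ⟨e, he, hep, heq⟩ := exists_separating_polynomial S p.1
    refine ⟨⟨(aeval p.1 e)⁻¹ • e, ?_⟩, ?_⟩
    · rw [mem_restrictTotalDegree]
      exact (totalDegree_smul_le _ _).trans (he.trans (by omega))
    · ext q
      rw [Pi.basisFun_apply, LinearMap.domRestrict_apply]
      simp only [ev, LinearMap.pi_apply, AlgHom.toLinearMap_apply, map_smul, smul_eq_mul]
      by_cases hqp : q = p
      · subst hqp
        rw [Pi.single_eq_same, inv_mul_cancel₀ hep]
      · rw [Pi.single_eq_of_ne hqp, heq q.1 q.2 (fun h => hqp (Subtype.ext h)), mul_zero]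
  have hrn := LinearMap.finrank_range_add_finrank_ker (ev.domRestrict (W (a + b + s)))
  rw [hsurj, finrank_top, Module.finrank_fintype_fun_eq_card, Fintype.card_coe] at hrn
  have h1 : Module.finrank K ↥(U₁ ⊔ U₂) ≤
      Module.finrank K (LinearMap.ker (ev.domRestrict (W (a + b + s)))) := by
    rw [← (Submodule.comapSubtypeEquivOfLe hU).finrank_eq]
    refine Submodule.finrank_mono fun x hx => ?_
    exact hker hx
  have h2 := Submodule.finrank_sup_add_finrank_inf_eq U₁ U₂
  have h3 := Submodule.finrank_mono hinf
  rw [finrank_map_mulLeft (mul_ne_zero hf hg)] at h3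
  rw [finrank_map_mulLeft hf, finrank_map_mulLeft hg] at h2
  -- With `w k = (k + 1)(k + 2) / 2`, the count reads `s ≤ w (a + b + s) - w (b + s) - w (a + s) + w
  -- s = a b`.
  have e1 := two_mul_finrank_restrictTotalDegree (K := K) (a + b + s)
  have e2 := two_mul_finrank_restrictTotalDegree (K := K) (b + s)
  have e3 := two_mul_finrank_restrictTotalDegree (K := K) (a + s)
  have e4 := two_mul_finrank_restrictTotalDegree (K := K) s
  simp only [W] at *
  nlinarith

/-- Bézout's bound for two plane curves of degree at most `m` with finite intersection. -/
lemma encard_le_sq_of_finite [IsAlgClosed K] {f g : MvPolynomial (Fin 2) K} {m : ℕ}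
    (hf : f.totalDegree ≤ m) (hg : g.totalDegree ≤ m)
    (hfin : {x : Fin 2 → K | aeval x f = 0 ∧ aeval x g = 0}.Finite) :
    {x : Fin 2 → K | aeval x f = 0 ∧ aeval x g = 0}.encard ≤ (m : ℕ∞) ^ 2 := by
  wlog hf0 : f ≠ 0 generalizing f g
  · rw [not_not] at hf0
    by_cases hg0 : g = 0
    · subst hf0 hg0
      have := IsAlgClosed.instInfinite (K := K)
      simp [Set.infinite_univ.not_finite] at hfin
    · have hsymm : {x : Fin 2 → K | aeval x f = 0 ∧ aeval x g = 0} =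
          {x | aeval x g = 0 ∧ aeval x f = 0} := Set.ext fun x => and_comm
      rw [hsymm] at hfin ⊢
      exact this hg hf hfin hg0
  -- A nonconstant common factor `c` would contribute infinitely many common zeros, so `c` is a
  -- nonzero constant and can be dropped.
  obtain ⟨f', g', c, hrel, rfl, rfl⟩ := UniqueFactorizationMonoid.exists_reduced_factors f hf0 g
  have hc0 := left_ne_zero_of_mul hf0
  have hf'0 := right_ne_zero_of_mul hf0
  have hc : c.totalDegree = 0 := by
    by_contra hc
    refine (infinite_zeros_of_totalDegree_pos (Nat.pos_of_ne_zero hc)) (hfin.subset ?_)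
    intro x hx
    simp only [Set.mem_ofPred_eq] at hx ⊢
    rw [map_mul, map_mul, hx, zero_mul, zero_mul]
    exact ⟨rfl, rfl⟩
  rw [totalDegree_eq_zero_iff_eq_C] at hc
  have hcx : ∀ x : Fin 2 → K, aeval x c ≠ 0 := fun x hx => by
    rw [hc, aeval_C] at hx
    exact hc0 (by rw [hc]; simpa using hx)
  have hset : {x : Fin 2 → K | aeval x (c * f') = 0 ∧ aeval x (c * g') = 0} =
      {x | aeval x f' = 0 ∧ aeval x g' = 0} := by
    ext x
    simp only [Set.mem_ofPred_eq, map_mul, mul_eq_zero, hcx, false_or]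
  rw [hset] at hfin ⊢
  by_cases hg0 : g' = 0
  · subst hg0
    obtain ⟨u, hu⟩ := hrel dvd_rfl (dvd_zero f')
    have : {x : Fin 2 → K | aeval x f' = 0 ∧ aeval x (0 : MvPolynomial (Fin 2) K) = 0} = ∅ := by
      refine Set.eq_empty_of_forall_notMem fun x hx => ?_
      have := (u.isUnit.map (aeval x : MvPolynomial (Fin 2) K →ₐ[K] K))
      rw [hu, hx.1] at this
      exact not_isUnit_zero this
    rw [this, Set.encard_empty]
    exact zero_le
  · rw [hfin.encard_eq_coe_toFinset_card]
    have := card_le_mul_of_isRelPrime hf'0 hg0 hrel hfin.toFinset (fun p hp => by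
      simpa using hp)
    rw [totalDegree_mul_of_isDomain hc0 hf'0] at hf
    rw [totalDegree_mul_of_isDomain hc0 hg0] at hg
    have h2 : f'.totalDegree * g'.totalDegree ≤ m ^ 2 := by
      rw [sq]; exact Nat.mul_le_mul (by omega) (by omega)
    exact_mod_cast this.trans h2

end PlaneCurves

/-! ### The degree of a hypersurface -/

section GeometricDegree

variable {K : Type*} [Field K] {σ : Type*}

/-- The first equation, having a natural number on the right, rules out the values `⊥` and `⊤` of
the dimension, so cancellation is legitimate. -/
lemma eq_of_add_dimension {V : Set (σ → K)} {a c N : ℕ}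
    (h1 : dimension V + (c : ℕ) = (N : ℕ∞)) (h2 : (a : WithBot ℕ∞) + dimension V = N) :
    a = c := by
  revert h1 h2
  generalize dimension V = d
  induction d using WithBot.recBotCoe with
  | bot => simp
  | coe d =>
    induction d using ENat.recTopCoe with
    | top =>
      intro h1
      norm_cast at h1
    | coe d =>
      intro h1 h2
      norm_cast at h1 h2
      omega

lemma add_dimension_eq {V : Set (σ → K)} {c N : ℕ} (h : dimension V + (c : ℕ) = (N : ℕ∞)) :
    (c : WithBot ℕ∞) + dimension V = N := by
  rw [add_comm]; exact h

lemma exists_parametrization [Finite σ] (L : AffineSubspace K (σ → K))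
    (hL : (L : Set (σ → K)).Nonempty) {k : ℕ} (hk : Module.finrank K L.direction = k) :
    ∃ (p : σ → K) (v : σ → Fin k → K),
      Function.Injective (fun (t : Fin k → K) i => p i + ∑ j, v i j * t j) ∧
      (L : Set (σ → K)) = Set.range fun (t : Fin k → K) i => p i + ∑ j, v i j * t j := by
  obtain ⟨p, hp⟩ := hL
  let b := Module.finBasisOfFinrankEq K L.direction hk
  have key : ∀ t : Fin k → K, (fun i => p i + ∑ j, (b j : σ → K) i * t j) =
      (b.equivFun.symm t : σ → K) +ᵥ p := by
    intro t
    ext i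
    rw [Module.Basis.equivFun_symm_apply]
    simp [mul_comm, add_comm]
  refine ⟨p, fun i j => (b j : σ → K) i, fun s t hst => ?_, Set.ext fun x => ⟨fun hx => ?_, ?_⟩⟩
  · simp only [key] at hst
    exact b.equivFun.symm.injective (Subtype.ext (vadd_right_cancel p hst))
  · refine ⟨b.equivFun ⟨x -ᵥ p, AffineSubspace.vsub_mem_direction hx hp⟩, ?_⟩
    simp only [key]
    simp
  · rintro ⟨t, rfl⟩
    simp only [key]
    exact AffineSubspace.vadd_mem_of_mem_direction (b.equivFun.symm t).2 hp

lemma inter_line_eq_image (F : MvPolynomial σ K) (p v : σ → K) :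
    (zeroLocus K (Ideal.span {F}) ∩ Set.range fun (t : K) i => p i + v i * t) =
      (fun (t : K) i => p i + v i * t) '' {t | (lineRestriction p v F).eval t = 0} := by
  ext x
  constructor
  · rintro ⟨h, t, rfl⟩
    refine ⟨t, ?_, rfl⟩
    rw [Set.mem_ofPred_eq, eval_lineRestriction]
    exact mem_zeroLocus_span_singleton.1 h
  · rintro ⟨t, ht, rfl⟩
    refine ⟨mem_zeroLocus_span_singleton.2 ?_, t, rfl⟩
    rwa [Set.mem_ofPred_eq, eval_lineRestriction] at ht

lemma inter_line_encard_eq [DecidableEq K] {F : MvPolynomial σ K} {p v : σ → K}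
    (hinj : Function.Injective fun (t : K) i => p i + v i * t)
    (h0 : lineRestriction p v F ≠ 0) :
    (zeroLocus K (Ideal.span {F}) ∩ Set.range fun (t : K) i => p i + v i * t).encard =
      (lineRestriction p v F).roots.toFinset.card := by
  have hroots : {t | (lineRestriction p v F).eval t = 0} =
      ((lineRestriction p v F).roots.toFinset : Set K) := by
    ext t
    simp [h0]
  rw [inter_line_eq_image, hinj.encard_image, hroots, Set.encard_coe_eq_coe_finsetCard]

lemma inter_line_encard_le [Infinite K] {F : MvPolynomial σ K} {p v : σ → K}
    (hinj : Function.Injective fun (t : K) i => p i + v i * t)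
    (hfin : (zeroLocus K (Ideal.span {F}) ∩ Set.range fun (t : K) i => p i + v i * t).Finite) :
    (zeroLocus K (Ideal.span {F}) ∩ Set.range fun (t : K) i => p i + v i * t).encard ≤
      F.totalDegree := by
  classical
  have h0 : lineRestriction p v F ≠ 0 := by
    intro h0
    rw [inter_line_eq_image] at hfin
    refine Set.infinite_univ (α := K) ((hfin.of_finite_image hinj.injOn).subset ?_)
    intro t _
    simp [h0]
  rw [inter_line_encard_eq hinj h0]
  exact_mod_cast (Multiset.toFinset_card_le _).trans
    ((Polynomial.card_roots' _).trans (natDegree_lineRestriction_le p v F))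

lemma injective_line (p : σ → K) {v : σ → K} (hv : v ≠ 0) :
    Function.Injective fun (t : K) i => p i + v i * t := by
  obtain ⟨i, hi⟩ := Function.ne_iff.1 hv
  intro s t hst
  simpa [show v i ≠ 0 from hi] using congrFun hst i

/-- The automorphism `x ↦ x + t v` of the polynomial ring in `x` and `t`. -/
def shear (v : σ → K) : Polynomial (MvPolynomial σ K) →+* Polynomial (MvPolynomial σ K) :=
  Polynomial.eval₂RingHom (lineRestriction (A := MvPolynomial σ K) X fun i => C (v i)).toRingHom
    Polynomial.X

lemma shear_comp_shear (v w : σ → K) (h : v + w = 0) :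
    (shear v).comp (shear w) = RingHom.id _ := by
  refine Polynomial.ringHom_ext' (MvPolynomial.ringHom_ext ?_ ?_) ?_
  · intro a
    simp [shear, lineRestriction, algHom_C]
  · intro i
    have hi : C (w i) + C (v i) = (0 : MvPolynomial σ K) := by
      rw [← C_add, add_comm, ← Pi.add_apply, h, Pi.zero_apply, C_0]
    have hi' := congrArg (fun a => Polynomial.C a * Polynomial.X) hi
    simp only [Polynomial.C_add, add_mul, Polynomial.C_0, zero_mul] at hi'
    simp only [shear, lineRestriction, RingHom.comp_apply, Polynomial.coe_eval₂RingHom,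
      Polynomial.eval₂_C, AlgHom.toRingHom_eq_coe, RingHom.coe_coe, aeval_X,
      Polynomial.eval₂_add, Polynomial.eval₂_mul, Polynomial.eval₂_X, algHom_C, RingHom.id_apply,
      Polynomial.algebraMap_apply, MvPolynomial.algebraMap_eq]
    linear_combination hi'
  · simp [shear]

/-- `F(x + t v)` is the image of `F`, viewed as constant in `t`, under the shear automorphism. -/
lemma irreducible_shear_C {F : MvPolynomial σ K} (hF : Prime F) (v : σ → K) :
    Irreducible (lineRestriction (A := MvPolynomial σ K) X (fun i => C (v i)) F) := by
  let e : Polynomial (MvPolynomial σ K) ≃+* Polynomial (MvPolynomial σ K) :=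
    RingEquiv.ofRingHom (shear v) (shear (-v)) (shear_comp_shear _ _ (by simp))
      (shear_comp_shear _ _ (by simp))
  have h1 : Prime (e (Polynomial.C F)) :=
    (MulEquiv.prime_iff e).2 (Polynomial.prime_C_iff.2 hF)
  have h2 : e (Polynomial.C F) = lineRestriction (A := MvPolynomial σ K) X (fun i => C (v i)) F := by
    change shear v (Polynomial.C F) = _
    simp [shear]
  rw [← h2]
  exact h1.irreducible

lemma map_lineRestriction {A B : Type*} [CommRing A] [CommRing B] [Algebra K A] [Algebra K B]
    (φ : A →ₐ[K] B) (p v : σ → A) (F : MvPolynomial σ K) :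
    (lineRestriction p v F).map (φ : A →+* B) = lineRestriction (φ ∘ p) (φ ∘ v) F := by
  have : (Polynomial.mapAlgHom φ).comp (lineRestriction p v : MvPolynomial σ K →ₐ[K] _) =
      lineRestriction (φ ∘ p) (φ ∘ v) := by
    ext i : 1; simp [lineRestriction]
  exact DFunLike.congr_fun this F

-- By Gauss's lemma `P` stays irreducible over the fraction field, hence separable in characteristic
-- `0`; clearing denominators gives `r`. It plays the role of a discriminant: specializations with
-- `r ≠ 0` remain separable.
open Polynomial in
lemma exists_bezout_of_irreducible {R : Type*} [CommRing R] [IsDomain R]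
    [UniqueFactorizationMonoid R] [CharZero R] {P : R[X]} (hP : Irreducible P)
    (h0 : P.natDegree ≠ 0) :
    ∃ (r : R) (a b : R[X]), r ≠ 0 ∧ a * P + b * derivative P = Polynomial.C r := by
  have hprim := hP.isPrimitive h0
  let Q := FractionRing R
  have hinj : Function.Injective (algebraMap R Q) := IsFractionRing.injective R Q
  have hQ : CharZero Q := charZero_of_injective_algebraMap hinj
  have hirr : Irreducible (P.map (algebraMap R Q)) :=
    hprim.irreducible_iff_irreducible_map_fraction_map.1 hP
  obtain ⟨a, b, hab⟩ := hirr.separable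
  obtain ⟨d, hd, ha⟩ := IsLocalization.integerNormalization_spec (nonZeroDivisors R) a
  obtain ⟨e, he, hb⟩ := IsLocalization.integerNormalization_spec (nonZeroDivisors R) b
  refine ⟨d * e, Polynomial.C e * IsLocalization.integerNormalization (nonZeroDivisors R) a,
    Polynomial.C d * IsLocalization.integerNormalization (nonZeroDivisors R) b,
    mul_ne_zero (nonZeroDivisors.ne_zero hd) (nonZeroDivisors.ne_zero he), ?_⟩
  apply Polynomial.map_injective _ hinj
  rw [Polynomial.map_add, Polynomial.map_mul, Polynomial.map_mul, Polynomial.map_mul,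
    Polynomial.map_mul, ha, hb, ← Polynomial.derivative_map, Polynomial.map_C, Polynomial.map_C,
    Polynomial.map_C, map_mul, Polynomial.C_mul, algebra_compatible_smul Q d,
    algebra_compatible_smul Q e, Polynomial.smul_eq_C_mul, Polynomial.smul_eq_C_mul]
  linear_combination (Polynomial.C (algebraMap R Q d) * Polynomial.C (algebraMap R Q e)) * hab

/-- The direction avoids the zeros of the leading form, and the base point avoids those of the
discriminant-like `r` of `F(x + t v)`. The restriction is then separable of full degree. -/
lemma exists_line_encard_eq [Finite σ] [IsAlgClosed K] [CharZero K] {F : MvPolynomial σ K}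
    (hF : Irreducible F) :
    ∃ p v : σ → K, v ≠ 0 ∧
      (zeroLocus K (Ideal.span {F}) ∩ Set.range fun (t : K) i => p i + v i * t).encard =
        F.totalDegree := by
  classical
  have := IsAlgClosed.instInfinite (K := K)
  obtain ⟨v, hv⟩ := exists_aeval_homogeneousComponent_ne_zero hF.ne_zero
  have hpos := totalDegree_pos_of_irreducible hF
  have hv0 : v ≠ 0 := by
    rintro rfl
    rw [aeval_zero, constantCoeff_eq, coeff_homogeneousComponent, if_neg] at hv
    · simp at hv
    · simpa using hpos.ne
  set P := lineRestriction (A := MvPolynomial σ K) X (fun i => C (v i)) F with hPdef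
  have hmap : ∀ p : σ → K, P.map (aeval p : MvPolynomial σ K →ₐ[K] K) = lineRestriction p v F := by
    intro p
    rw [hPdef, map_lineRestriction]
    congr 1
    ext i; simp [Function.comp_def]
  have hdeg : ∀ p : σ → K, (lineRestriction p v F).natDegree = F.totalDegree := fun p =>
    le_antisymm (natDegree_lineRestriction_le p v F)
      (Polynomial.le_natDegree_of_ne_zero (by rwa [coeff_lineRestriction]))
  have hP0 : P.natDegree ≠ 0 := by
    have h1 := Polynomial.natDegree_map_le (f := ((aeval 0 : MvPolynomial σ K →ₐ[K] K) :
      MvPolynomial σ K →+* K)) (p := P)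
    rw [hmap, hdeg] at h1
    omega
  obtain ⟨r, a, b, hr, hab⟩ := exists_bezout_of_irreducible (irreducible_shear_C hF.prime v) hP0
  obtain ⟨p, hp⟩ : ∃ p : σ → K, aeval p r ≠ 0 := by
    by_contra! h
    exact hr (funext fun p => by simpa using h p)
  set φ : MvPolynomial σ K →+* K := ((aeval p : MvPolynomial σ K →ₐ[K] K) :
    MvPolynomial σ K →+* K)
  have hsep : (lineRestriction p v F).Separable := by
    have h2 := congrArg (Polynomial.map φ) hab
    rw [Polynomial.map_add, Polynomial.map_mul, Polynomial.map_mul, ← Polynomial.derivative_map,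
      hmap, Polynomial.map_C] at h2
    refine ⟨Polynomial.C (φ r)⁻¹ * a.map φ, Polynomial.C (φ r)⁻¹ * b.map φ, ?_⟩
    rw [mul_assoc, mul_assoc, ← mul_add, h2, ← Polynomial.C_mul, inv_mul_cancel₀ (show φ r ≠ 0 from hp),
      Polynomial.C_1]
  refine ⟨p, v, hv0, ?_⟩
  rw [inter_line_encard_eq (injective_line p hv0) hsep.ne_zero,
    Multiset.toFinset_card_of_nodup (Polynomial.nodup_roots hsep),
    ← (IsAlgClosed.splits (lineRestriction p v F)).natDegree_eq_card_roots, hdeg]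

/-- The degree of an irreducible hypersurface is the degree of its equation. -/
lemma geometricDegree_hypersurface [Fintype σ] [IsAlgClosed K] [CharZero K]
    {F : MvPolynomial σ K} (hF : Irreducible F) :
    geometricDegree (zeroLocus K (Ideal.span {F})) = F.totalDegree := by
  have := IsAlgClosed.instInfinite (K := K)
  have hdim : dimension (zeroLocus K (Ideal.span {F})) + (1 : ℕ) =
    ((Fintype.card σ : ℕ) : ℕ∞) := dimension_hypersurface hF
  refine le_antisymm ?_ ?_
  · refine iSup_le fun L => iSup_le fun hL => iSup_le fun hd => iSup_le fun hfin => ?_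
    obtain ⟨p, v, hinj, hLr⟩ := exists_parametrization L hL (eq_of_add_dimension hdim hd)
    have h1 : (fun (t : Fin 1 → K) i => p i + ∑ j, v i j * t j) =
        (fun (t : K) i => p i + v i 0 * t) ∘ (Equiv.funUnique (Fin 1) K) := by
      ext t i; simp
    rw [h1] at hinj hLr
    rw [(Equiv.surjective _).range_comp] at hLr
    rw [hLr] at hfin ⊢
    exact inter_line_encard_le ((Equiv.injective_comp _ _).1 hinj) hfin
  · obtain ⟨p, v, hv, hcard⟩ := exists_line_encard_eq hF
    have hL : ((AffineSubspace.mk' p (Submodule.span K {v}) : AffineSubspace K (σ → K)) :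
        Set (σ → K)) = Set.range fun (t : K) i => p i + v i * t := by
      ext x
      rw [SetLike.mem_coe, AffineSubspace.mem_mk', Submodule.mem_span_singleton]
      refine exists_congr fun t => ?_
      rw [vsub_eq_sub, eq_sub_iff_add_eq]
      simp only [funext_iff, Pi.add_apply, Pi.smul_apply, smul_eq_mul]
      exact forall_congr' fun i => by rw [add_comm, mul_comm]
    rw [← hcard, ← hL]
    refine le_iSup_of_le _ (le_iSup_of_le ⟨p, AffineSubspace.self_mem_mk' _ _⟩
      (le_iSup_of_le ?_ (le_iSup_of_le ?_ le_rfl)))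
    · rw [AffineSubspace.direction_mk', finrank_span_singleton hv]
      exact add_dimension_eq hdim
    · rw [← Set.encard_lt_top_iff, hL, hcard]
      exact ENat.natCast_lt_top _

end GeometricDegree

/-! ### The upper bound for the degree of the tangent bundle -/

section DegreeTangentBundle

variable {K : Type*} [Field K] {σ τ : Type*}

lemma totalDegree_aeval_le {g : σ → MvPolynomial τ K} (hg : ∀ i, (g i).totalDegree ≤ 1)
    (F : MvPolynomial σ K) : (aeval g F).totalDegree ≤ F.totalDegree := by
  rw [aeval_def, eval₂_eq]
  refine totalDegree_finsetSum_le fun d hd => ?_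
  rw [MvPolynomial.algebraMap_eq]
  refine (totalDegree_mul _ _).trans ?_
  rw [totalDegree_C, zero_add]
  refine (totalDegree_finsetProd _ _).trans (le_trans ?_ (le_totalDegree hd))
  refine Finset.sum_le_sum fun i _ => (totalDegree_pow _ _).trans ?_
  simpa using Nat.mul_le_mul_left (d i) (hg i)

/-- The restriction of a polynomial to a parametrized affine subspace. -/
def subspaceRestriction {k : ℕ} (p : σ → K) (v : σ → Fin k → K) :
    MvPolynomial σ K →ₐ[K] MvPolynomial (Fin k) K :=
  aeval fun i => C (p i) + ∑ j, C (v i j) * X j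

lemma totalDegree_subspaceRestriction_le {k : ℕ} (p : σ → K) (v : σ → Fin k → K)
    (F : MvPolynomial σ K) : (subspaceRestriction p v F).totalDegree ≤ F.totalDegree := by
  refine totalDegree_aeval_le (fun i => ?_) F
  refine (totalDegree_add _ _).trans (max_le (by simp) (totalDegree_finsetSum_le fun j _ => ?_))
  refine (totalDegree_mul _ _).trans ?_
  rw [totalDegree_C, totalDegree_X]

lemma aeval_subspaceRestriction {k : ℕ} (p : σ → K) (v : σ → Fin k → K) (t : Fin k → K)
    (F : MvPolynomial σ K) :
    aeval t (subspaceRestriction p v F) = aeval (fun i => p i + ∑ j, v i j * t j) F := by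
  have : (aeval t : MvPolynomial (Fin k) K →ₐ[K] K).comp (subspaceRestriction p v) =
      aeval fun i => p i + ∑ j, v i j * t j := by
    ext i; simp [subspaceRestriction]
  exact DFunLike.congr_fun this F

/-- Differentiation loses one degree and the factor `yᵢ` restores it; positivity keeps the
subtraction in `ℕ` from truncating. -/
lemma totalDegree_differential_le [Fintype σ] {F : MvPolynomial σ K} (hF : 0 < F.totalDegree) :
    (differential F).totalDegree ≤ F.totalDegree := by
  refine totalDegree_finsetSum_le fun i _ => (totalDegree_mul _ _).trans ?_
  have h1 := (totalDegree_rename_le (Sum.inl : σ → σ ⊕ σ) (pderiv i F)).trans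
    (totalDegree_pderiv_le F i)
  rw [totalDegree_X]
  omega

/-- A plane meeting the common zero set of two polynomials of degree at most `m` in finitely many
points meets it in at most `m ^ 2` points. -/
lemma inter_plane_encard_le [IsAlgClosed K] {F G : MvPolynomial σ K} {m : ℕ}
    (hF : F.totalDegree ≤ m) (hG : G.totalDegree ≤ m) {p : σ → K} {v : σ → Fin 2 → K}
    (hinj : Function.Injective fun (t : Fin 2 → K) i => p i + ∑ j, v i j * t j)
    (hfin : (zeroLocus K (Ideal.span {F, G}) ∩
      Set.range fun (t : Fin 2 → K) i => p i + ∑ j, v i j * t j).Finite) :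
    (zeroLocus K (Ideal.span {F, G}) ∩
      Set.range fun (t : Fin 2 → K) i => p i + ∑ j, v i j * t j).encard ≤ (m : ℕ∞) ^ 2 := by
  have hset : (zeroLocus K (Ideal.span {F, G}) ∩
      Set.range fun (t : Fin 2 → K) i => p i + ∑ j, v i j * t j) =
      (fun (t : Fin 2 → K) i => p i + ∑ j, v i j * t j) ''
        {t | aeval t (subspaceRestriction p v F) = 0 ∧
          aeval t (subspaceRestriction p v G) = 0} := by
    ext x
    constructor
    · rintro ⟨h, t, rfl⟩
      refine ⟨t, ?_, rfl⟩
      rw [Set.mem_ofPred_eq, aeval_subspaceRestriction, aeval_subspaceRestriction]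
      exact mem_zeroLocus_span_pair.1 h
    · rintro ⟨t, ht, rfl⟩
      rw [Set.mem_ofPred_eq, aeval_subspaceRestriction, aeval_subspaceRestriction] at ht
      exact ⟨mem_zeroLocus_span_pair.2 ht, t, rfl⟩
  rw [hset] at hfin ⊢
  rw [hinj.encard_image]
  exact encard_le_sq_of_finite ((totalDegree_subspaceRestriction_le p v F).trans hF)
    ((totalDegree_subspaceRestriction_le p v G).trans hG) (hfin.of_finite_image hinj.injOn)

lemma geometricDegree_tangentBundle_le [Fintype σ] [IsAlgClosed K] [CharZero K]
    {F : MvPolynomial σ K} (hF : Irreducible F) :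
    geometricDegree (tangentBundle (zeroLocus K (Ideal.span {F}))) ≤
      (F.totalDegree : ℕ∞) ^ 2 := by
  have hdim : dimension (tangentBundle (zeroLocus K (Ideal.span {F}))) + (2 : ℕ) =
    ((Fintype.card (σ ⊕ σ) : ℕ) : ℕ∞) := dimension_tangentBundle hF
  refine iSup_le fun L => iSup_le fun hL => iSup_le fun hd => iSup_le fun hfin => ?_
  obtain ⟨p, v, hinj, hLr⟩ := exists_parametrization L hL (eq_of_add_dimension hdim hd)
  rw [hLr, tangentBundle_eq hF] at hfin ⊢
  exact inter_plane_encard_le (totalDegree_rename_le _ F)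
    (totalDegree_differential_le (totalDegree_pos_of_irreducible hF)) hinj hfin

end DegreeTangentBundle

/-! ### The Jacobian criterion for hypersurfaces -/

section Smoothness

variable {K : Type*} [Field K] {σ : Type*}

/-- The ideal generated by the functions `xᵢ - pᵢ`. -/
def coordinateIdeal (p : σ → K) : Ideal (MvPolynomial σ K) :=
  Ideal.span (Set.range fun i => X i - C (p i))

lemma sub_mem_coordinateIdeal (p : σ → K) (i : σ) : X i - C (p i) ∈ coordinateIdeal p :=
  Ideal.subset_span ⟨i, rfl⟩

lemma taylor_mem_sq [Fintype σ] (p : σ → K) (f : MvPolynomial σ K) :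
    f - C (aeval p f) - ∑ i, C (aeval p (pderiv i f)) * (X i - C (p i)) ∈
      coordinateIdeal p ^ 2 := by
  classical
  induction f using MvPolynomial.induction_on with
  | C a => simp
  | add f g hf hg =>
    convert add_mem hf hg using 1
    simp only [map_add, add_mul, Finset.sum_add_distrib]
    ring
  | mul_X f j hf =>
    have h1 : (∑ i, C (aeval p (pderiv i f)) * (X i - C (p i))) * (X j - C (p j)) ∈
        coordinateIdeal p ^ 2 := by
      rw [sq]
      exact Ideal.mul_mem_mul (Ideal.sum_mem _ fun i _ =>
        Ideal.mul_mem_left _ _ (sub_mem_coordinateIdeal p i)) (sub_mem_coordinateIdeal p j)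
    -- If `f` has linear part `L` and remainder `R`, then `f xⱼ` has remainder `R xⱼ + L (xⱼ - pⱼ)`.
    convert add_mem (Ideal.mul_mem_right (X j) _ hf) h1 using 1
    have h2 : ∑ i, C (aeval p (pderiv i (f * X j))) * (X i - C (p i)) =
        C (p j) * (∑ i, C (aeval p (pderiv i f)) * (X i - C (p i))) +
          C (aeval p f) * (X j - C (p j)) := by
      have h3 : C (aeval p f) * (X j - C (p j)) = ∑ i, if i = j then
          C (aeval p f) * (X i - C (p i)) else (0 : MvPolynomial σ K) := by simp
      rw [h3, Finset.mul_sum, ← Finset.sum_add_distrib]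
      refine Finset.sum_congr rfl fun i _ => ?_
      rw [pderiv_mul, pderiv_X, map_add, map_mul, map_mul, aeval_X, C_add, C_mul]
      by_cases hij : i = j
      · subst hij
        simp only [Pi.single_eq_same, map_one, if_true, C_mul]
        ring
      · simp only [Pi.single_eq_of_ne' hij, map_zero, if_neg hij, C_mul]
        ring
    rw [h2, map_mul, aeval_X, C_mul]
    ring

lemma vanishingIdeal_singleton_eq [Finite σ] (p : σ → K) :
    vanishingIdeal K {p} = coordinateIdeal p := by
  have := Fintype.ofFinite σ
  refine le_antisymm (fun f hf => ?_) (Ideal.span_le.2 ?_)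
  · rw [mem_vanishingIdeal_singleton_iff] at hf
    have h1 := Ideal.pow_le_self two_ne_zero (taylor_mem_sq p f)
    rw [hf, C_0, sub_zero] at h1
    rw [← sub_add_cancel f (∑ i, C (aeval p (pderiv i f)) * (X i - C (p i)))]
    exact add_mem h1 (Ideal.sum_mem _ fun i _ =>
        Ideal.mul_mem_left _ _ (sub_mem_coordinateIdeal p i))
  · rintro _ ⟨i, rfl⟩
    simp

lemma pointIdeal_eq_map (V : Set (σ → K)) (p : V) :
    pointIdeal V p = (vanishingIdeal K {(p : σ → K)}).map
      (Ideal.Quotient.mk (vanishingIdeal K V)) := by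
  rw [← Ideal.map_comap_of_surjective _ Ideal.Quotient.mk_surjective (pointIdeal V p)]
  congr 1
  ext f
  simp only [pointIdeal, Ideal.mem_comap, RingHom.mem_ker, evalAt, Ideal.Quotient.lift_mk,
    mem_vanishingIdeal_singleton_iff]
  rfl

lemma maximalIdeal_localRingAt [Finite σ] (V : Set (σ → K)) (p : V) :
    IsLocalRing.maximalIdeal (LocalRingAt V p) = (coordinateIdeal (p : σ → K)).map
      ((algebraMap (CoordinateRing V) (LocalRingAt V p)).comp (Ideal.Quotient.mk _)) := by
  rw [← Ideal.map_map, ← vanishingIdeal_singleton_eq, ← pointIdeal_eq_map]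
  exact (Localization.AtPrime.map_eq_maximalIdeal).symm

/-- If the differential of an equation is nonzero at a point, the maximal ideal of the local ring
needs fewer generators than there are coordinates. -/
lemma spanFinrank_maximalIdeal_add_one_le [Fintype σ] {B : Type*} [CommRing B] [IsLocalRing B]
    [IsNoetherianRing B] (ψ : MvPolynomial σ K →+* B) {p : σ → K}
    (hB : IsLocalRing.maximalIdeal B = (coordinateIdeal p).map ψ) {F : MvPolynomial σ K}
    (hψF : ψ F = 0) (hFp : aeval p F = 0) {i₀ : σ} (hi₀ : aeval p (pderiv i₀ F) ≠ 0) :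
    ((IsLocalRing.maximalIdeal B).spanFinrank : ℕ∞) + 1 ≤ Fintype.card σ := by
  classical
  set M := IsLocalRing.maximalIdeal B
  let y : σ → B := fun i => ψ (X i - C (p i))
  have hMspan : M = Ideal.span (Set.range y) := by
    rw [hB, coordinateIdeal, Ideal.map_span, ← Set.range_comp]
    rfl
  let N : Ideal B := Ideal.span (y '' {i₀}ᶜ)
  -- As `F` becomes zero in `B`, its Taylor expansion puts the linear part in `M ^ 2`; the unit
  -- coefficient at `i₀` then makes `y i₀` redundant modulo `M ^ 2`.
  have hlin : ∑ i, ψ (C (aeval p (pderiv i F))) * y i ∈ M ^ 2 := by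
    have h1 := Ideal.mem_map_of_mem ψ (taylor_mem_sq p F)
    rw [Ideal.map_pow, ← hB, hFp, C_0, sub_zero, map_sub, hψF, zero_sub, neg_mem_iff,
      map_sum] at h1
    simpa only [map_mul] using h1
  have hy₀ : y i₀ ∈ N ⊔ M • M := by
    have hunit : IsUnit (ψ (C (aeval p (pderiv i₀ F)))) :=
      ((IsUnit.mk0 _ hi₀).map C).map ψ
    rw [← Ideal.unit_mul_mem_iff_mem _ hunit]
    rw [← Finset.add_sum_erase _ _ (Finset.mem_univ i₀)] at hlin
    have hrest : ∑ i ∈ Finset.univ.erase i₀, ψ (C (aeval p (pderiv i F))) * y i ∈ N :=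
      Ideal.sum_mem _ fun i hi => Ideal.mul_mem_left _ _
        (Ideal.subset_span ⟨i, Finset.ne_of_mem_erase hi, rfl⟩)
    rw [sq, ← smul_eq_mul] at hlin
    rw [← add_sub_cancel_right (ψ (C (aeval p (pderiv i₀ F))) * y i₀)
      (∑ i ∈ Finset.univ.erase i₀, ψ (C (aeval p (pderiv i F))) * y i)]
    exact sub_mem (Submodule.mem_sup_right hlin) (Submodule.mem_sup_left hrest)
  have hMle : M ≤ N ⊔ M • M := by
    conv_lhs => rw [hMspan]
    rw [Ideal.span_le]
    rintro _ ⟨i, rfl⟩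
    by_cases hi : i = i₀
    · rw [hi]; exact hy₀
    · exact Submodule.mem_sup_left (Ideal.subset_span ⟨i, hi, rfl⟩)
  -- Nakayama's lemma.
  have hMN : M = N := by
    refine le_antisymm (Submodule.le_of_le_smul_of_le_jacobson_bot
      (IsNoetherian.noetherian M) (IsLocalRing.maximalIdeal_le_jacobson _) hMle) ?_
    rw [hMspan]
    exact Ideal.span_mono (Set.image_subset_range _ _)
  rw [hMN]
  calc ((N.spanFinrank : ℕ) : ℕ∞) + 1 ≤ ({i₀}ᶜ : Set σ).encard + 1 := by
        gcongr
        exact (Submodule.spanFinrank_span_le_encard _).trans (Set.encard_image_le _ _)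
    _ = Fintype.card σ := by
        rw [← Set.encard_singleton i₀, add_comm, Set.encard_add_encard_compl,
          Set.encard_univ, ENat.card_eq_coe_fintype_card]

/-- A hypersurface is regular at the points where the gradient of its equation is nonzero. -/
lemma isRegularLocalRing_of_pderiv_ne_zero [Fintype σ] [IsAlgClosed K] {F : MvPolynomial σ K}
    {V : Set (σ → K)} (hI : vanishingIdeal K V = Ideal.span {F}) (p : V) {i₀ : σ}
    (hi₀ : aeval (p : σ → K) (pderiv i₀ F) ≠ 0) :
    IsRegularLocalRing (LocalRingAt V p) := by
  have hFV : F ∈ vanishingIdeal K V := hI ▸ Ideal.mem_span_singleton_self F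
  have h1 := spanFinrank_maximalIdeal_add_one_le (B := LocalRingAt V p)
    ((algebraMap (CoordinateRing V) (LocalRingAt V p)).comp (Ideal.Quotient.mk _))
    (maximalIdeal_localRingAt V p) (F := F)
    (by rw [RingHom.comp_apply, Ideal.Quotient.eq_zero_iff_mem.2 hFV, map_zero])
    (hFV p p.2) hi₀
  refine IsRegularLocalRing.of_spanFinrank_maximalIdeal_le _ ?_
  rw [IsLocalization.AtPrime.ringKrullDim_eq_height (pointIdeal V p) (LocalRingAt V p)]
  have hle : vanishingIdeal K V ≤ vanishingIdeal K {(p : σ → K)} :=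
    vanishingIdeal_anti_mono (Set.singleton_subset_iff.2 p.2)
  -- Dividing by the single equation `F` lowers the height of the ideal of a point by at most one.
  have h2 : (Fintype.card σ : ℕ∞) ≤ (pointIdeal V p).height + 1 := by
    rw [← height_vanishingIdeal_singleton (p : σ → K), pointIdeal_eq_map]
    refine (Ideal.height_le_height_add_spanFinrank_of_le hle).trans ?_
    gcongr
    rw [hI]
    simpa using Submodule.spanFinrank_span_le_encard (R := MvPolynomial σ K)
      ({F} : Set (MvPolynomial σ K))
  have h3 := h1.trans h2
  rw [ENat.add_le_add_iff_right ENat.one_ne_top] at h3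
  exact WithBot.coe_le_coe.2 h3

end Smoothness

/-! ### Sharpness: the Fermat cylinder -/

section Fermat

variable {K : Type*} [Field K]

/-- The Fermat polynomial `x₀ ^ m + x₁ ^ m - 1`. -/
def fermat (K : Type*) [Field K] (n m : ℕ) : MvPolynomial (Fin (n + 2)) K :=
  X 0 ^ m + X 1 ^ m - 1

lemma finSuccEquiv_fermat (n m : ℕ) :
    finSuccEquiv K (n + 1) (fermat K n m) =
      Polynomial.X ^ m + Polynomial.C (X 0 ^ m - 1) := by
  have h1 : (1 : Fin (n + 2)) = Fin.succ 0 := rfl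
  simp only [fermat, map_sub, map_add, map_pow, map_one, finSuccEquiv_X_zero]
  rw [h1, finSuccEquiv_X_succ]
  ring

lemma irreducible_X {σ : Type*} (i : σ) : Irreducible (X i : MvPolynomial σ K) :=
  irreducible_of_totalDegree_eq_one (totalDegree_X i) fun a ha =>
    isUnit_of_dvd_one (by simpa using ha (Finsupp.single i 1))

lemma prime_X_sub_one {σ : Type*} (i : σ) : Prime (X i - 1 : MvPolynomial σ K) := by
  rw [← MulEquiv.prime_iff (translate (K := K) fun _ : σ => 1)]
  have : translate (K := K) (fun _ : σ => 1) (X i - 1) = X i := by simp [translate]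
  rw [this]
  exact (irreducible_X i).prime

/-- The derivative at `1` would vanish, but it equals `m`. -/
lemma not_sq_dvd_X_pow_sub_one [CharZero K] {σ : Type*} (i : σ) {m : ℕ} (hm : m ≠ 0) :
    ¬ (X i - 1 : MvPolynomial σ K) ^ 2 ∣ X i ^ m - 1 := by
  rintro ⟨h, hh⟩
  have := congrArg (fun f => aeval (fun _ => (1 : K)) (pderiv i f)) hh
  simp at this
  exact hm this

/-- Eisenstein's criterion in `x₀` at the prime `x₁ - 1`, which divides `x₁ ^ m - 1` exactly once.
-/
lemma irreducible_fermat [CharZero K] (n : ℕ) {m : ℕ} (hm : m ≠ 0) :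
    Irreducible (fermat K n m) := by
  rw [← MulEquiv.irreducible_iff (finSuccEquiv K (n + 1)), finSuccEquiv_fermat]
  have hmonic := Polynomial.monic_X_pow_add_C (X 0 ^ m - 1 : MvPolynomial (Fin (n + 1)) K) hm
  have hdvd : (X 0 - 1 : MvPolynomial (Fin (n + 1)) K) ∣ X 0 ^ m - 1 := by
    simpa using sub_dvd_pow_sub_pow (X 0 : MvPolynomial (Fin (n + 1)) K) 1 m
  have hP : (Ideal.span {(X 0 - 1 : MvPolynomial (Fin (n + 1)) K)}).IsPrime :=
    (Ideal.span_singleton_prime (prime_X_sub_one 0).ne_zero).2 (prime_X_sub_one 0)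
  have hdeg : (Polynomial.X ^ m + Polynomial.C (X 0 ^ m - 1 : MvPolynomial (Fin (n + 1)) K)).degree
      = (m : WithBot ℕ) := Polynomial.degree_X_pow_add_C (Nat.pos_of_ne_zero hm) _
  refine Polynomial.irreducible_of_eisenstein_criterion hP ?_ ?_ ?_ ?_ hmonic.isPrimitive
  · rw [hmonic.leadingCoeff]
    exact fun h => hP.ne_top ((Ideal.eq_top_iff_one _).2 h)
  · intro k hk
    rw [hdeg] at hk
    have hk' : k < m := by exact_mod_cast hk
    rw [Polynomial.coeff_add, Polynomial.coeff_X_pow, if_neg hk'.ne, zero_add,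
      Polynomial.coeff_C]
    split_ifs
    · exact Ideal.mem_span_singleton.2 hdvd
    · exact zero_mem _
  · rw [hdeg]
    exact_mod_cast Nat.pos_of_ne_zero hm
  · rw [Polynomial.coeff_add, Polynomial.coeff_X_pow, if_neg hm.symm, zero_add,
      Polynomial.coeff_C_zero, Ideal.span_singleton_pow, Ideal.mem_span_singleton]
    exact not_sq_dvd_X_pow_sub_one 0 hm

lemma totalDegree_fermat (n m : ℕ) :
    (fermat K n m).totalDegree = m := by
  refine le_antisymm ?_ ?_
  · have h : ∀ i : Fin (n + 2), (X i ^ m : MvPolynomial (Fin (n + 2)) K).totalDegree ≤ m :=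
      fun i => (totalDegree_X_pow i m).le
    exact (totalDegree_sub _ _).trans
      (max_le ((totalDegree_add _ _).trans (max_le (h 0) (h 1))) (by simp))
  · refine le_trans ?_ (degreeOf_le_totalDegree (fermat K n m) 0)
    rw [← natDegree_finSuccEquiv, finSuccEquiv_fermat, Polynomial.natDegree_X_pow_add_C]

lemma pderiv_fermat (n m : ℕ) (i : Fin (n + 2)) :
    pderiv i (fermat K n m) = if i = 0 then C (m : K) * X 0 ^ (m - 1) else
      if i = 1 then C (m : K) * X 1 ^ (m - 1) else 0 := by
  classical
  rw [fermat, map_sub, map_add, pderiv_pow, pderiv_pow, pderiv_X, pderiv_X, pderiv_one]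
  by_cases h0 : i = 0
  · subst h0
    simp
  · by_cases h1 : i = 1
    · subst h1
      simp
    · simp [h0, h1]

/-- If both partial derivatives vanished, then `x₀ ^ m = x₁ ^ m = 0`, contradicting `x₀ ^ m + x₁ ^ m
= 1`. -/
lemma isSmoothVariety_fermat [IsAlgClosed K] [CharZero K] (n : ℕ) {m : ℕ} (hm : m ≠ 0) :
    IsSmoothVariety (zeroLocus K (Ideal.span {fermat K n m})) := by
  intro p
  have hI := vanishingIdeal_zeroLocus_of_irreducible (irreducible_fermat (K := K) n hm)
  have hp : (p : Fin (n + 2) → K) 0 ^ m + (p : Fin (n + 2) → K) 1 ^ m - 1 = 0 := by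
    simpa [fermat] using mem_zeroLocus_span_singleton.1 p.2
  have hm0 : (m : K) ≠ 0 := by exact_mod_cast hm
  by_cases h0 : (p : Fin (n + 2) → K) 0 ^ (m - 1) = 0
  · by_cases h1 : (p : Fin (n + 2) → K) 1 ^ (m - 1) = 0
    · have h2 : ∀ a : K, a ^ (m - 1) = 0 → a ^ m = 0 := fun a ha => by
        rw [← Nat.sub_one_add_one hm, pow_succ, ha, zero_mul]
      simp [h2 _ h0, h2 _ h1] at hp
    · refine isRegularLocalRing_of_pderiv_ne_zero hI p (i₀ := 1) ?_
      rw [pderiv_fermat]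
      simpa [hm0] using h1
  · refine isRegularLocalRing_of_pderiv_ne_zero hI p (i₀ := 0) ?_
    rw [pderiv_fermat]
    simpa [hm0] using h0

/-- The plane `y₀ = x₀`, `y₁ = - x₁`, all other coordinates zero. -/
def fermatPlane (K : Type*) [Field K] (n : ℕ) :
    (Fin 2 → K) →ₗ[K] (Fin (n + 2) ⊕ Fin (n + 2) → K) where
  toFun s := Sum.elim (fun i => if i = 0 then s 0 else if i = 1 then s 1 else 0)
    (fun i => if i = 0 then s 0 else if i = 1 then - s 1 else 0)
  map_add' s t := by
    ext (i | i) <;> simp only [Sum.elim_inl, Sum.elim_inr, Pi.add_apply] <;> split_ifs <;> ring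
  map_smul' a s := by
    ext (i | i) <;> simp only [Sum.elim_inl, Sum.elim_inr, Pi.smul_apply, smul_eq_mul,
      RingHom.id_apply] <;> split_ifs <;> ring

lemma injective_fermatPlane (n : ℕ) : Function.Injective (fermatPlane K n) := by
  intro s t h
  have h0 := congrFun h (Sum.inl 0)
  have h1 := congrFun h (Sum.inl 1)
  simp [fermatPlane] at h0 h1
  ext i
  fin_cases i
  · exact h0
  · exact h1

/-- The signs in the plane turn the differential into `m (s₀ ^ m - s₁ ^ m)`; with `s₀ ^ m + s₁ ^ m =
1` this leaves a linear system in the two powers. -/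
lemma fermatPlane_mem_tangentBundle_iff [IsAlgClosed K] [CharZero K] (n : ℕ) {m : ℕ} (hm : m ≠ 0)
    (s : Fin 2 → K) :
    fermatPlane K n s ∈ tangentBundle (zeroLocus K (Ideal.span {fermat K n m})) ↔
      ∀ i, s i ^ m = 1 / 2 := by
  have hm0 : (m : K) ≠ 0 := by exact_mod_cast hm
  rw [tangentBundle_eq (irreducible_fermat n hm), mem_zeroLocus_span_pair, aeval_rename,
    aeval_differential, Fin.sum_univ_succ, Fin.sum_univ_succ]
  have h2 : ∀ a : K, a ^ (m - 1) * a = a ^ m := fun a => pow_sub_one_mul hm a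
  have hrest : ∀ i : Fin n, pderiv i.succ.succ (fermat K n m) = 0 := fun i => by
    rw [pderiv_fermat, if_neg (Fin.succ_ne_zero _), if_neg]
    exact fun h => Fin.succ_ne_zero i (Fin.succ_injective _ h)
  simp only [hrest, map_zero, zero_mul, Finset.sum_const_zero, add_zero]
  have h01 : (Fin.succ 0 : Fin (n + 2)) = 1 := rfl
  rw [h01, pderiv_fermat, pderiv_fermat]
  simp only [fermat, fermatPlane, if_true, one_ne_zero, if_false, LinearMap.coe_mk,
    AddHom.coe_mk, map_sub, map_add, map_pow, map_mul, aeval_X, map_one, aeval_C,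
    Function.comp_apply, Sum.elim_inl, Sum.elim_inr, Fin.forall_fin_two]
  simp only [Algebra.algebraMap_self, RingHom.id_apply]
  have hG : (m : K) * s 0 ^ (m - 1) * s 0 + m * s 1 ^ (m - 1) * -s 1 =
      m * (s 0 ^ m - s 1 ^ m) := by rw [← h2 (s 0), ← h2 (s 1)]; ring
  rw [hG, mul_eq_zero, or_iff_right hm0]
  constructor
  · rintro ⟨ha, hb⟩
    constructor
    · linear_combination (1 / 2 : K) * ha + (1 / 2 : K) * hb
    · linear_combination (1 / 2 : K) * ha - (1 / 2 : K) * hb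
  · rintro ⟨ha, hb⟩
    rw [ha, hb]
    norm_num

lemma encard_pow_eq_half [IsAlgClosed K] [CharZero K] {m : ℕ} (hm : m ≠ 0) :
    {s : Fin 2 → K | ∀ i, s i ^ m = 1 / 2}.encard = (m : ℕ∞) ^ 2 := by
  classical
  have hsep := Polynomial.separable_X_pow_sub_C (1 / 2 : K) (n := m) (by exact_mod_cast hm)
    (by norm_num)
  set T := (Polynomial.X ^ m - Polynomial.C (1 / 2 : K)).roots.toFinset with hT
  have hset : {s : Fin 2 → K | ∀ i, s i ^ m = 1 / 2} =
      (Fintype.piFinset fun _ : Fin 2 => T : Set (Fin 2 → K)) := by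
    ext s
    simp only [Set.mem_ofPred_eq, Finset.mem_coe, Fintype.mem_piFinset, hT,
      Multiset.mem_toFinset, Polynomial.mem_roots hsep.ne_zero, Polynomial.IsRoot.def,
      Polynomial.eval_sub, Polynomial.eval_pow, Polynomial.eval_X, Polynomial.eval_C, sub_eq_zero]
  have hcard : T.card = m := by
    rw [hT, Multiset.toFinset_card_of_nodup (Polynomial.nodup_roots hsep),
      ← (IsAlgClosed.splits _).natDegree_eq_card_roots, Polynomial.natDegree_X_pow_sub_C]
  rw [hset, Set.encard_coe_eq_coe_finsetCard, Fintype.card_piFinset_const, hcard]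
  simp

lemma le_geometricDegree_tangentBundle_fermat [IsAlgClosed K] [CharZero K] (n : ℕ) {m : ℕ}
    (hm : m ≠ 0) : (m : ℕ∞) ^ 2 ≤
      geometricDegree (tangentBundle (zeroLocus K (Ideal.span {fermat K n m}))) := by
  have hdim : dimension (tangentBundle (zeroLocus K (Ideal.span {fermat K n m}))) + (2 : ℕ) =
    ((Fintype.card (Fin (n + 2) ⊕ Fin (n + 2)) : ℕ) : ℕ∞) :=
    dimension_tangentBundle (irreducible_fermat n hm)
  have hinter : tangentBundle (zeroLocus K (Ideal.span {fermat K n m})) ∩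
      ((LinearMap.range (fermatPlane K n)).toAffineSubspace : Set _) =
      fermatPlane K n '' {s | ∀ i, s i ^ m = 1 / 2} := by
    ext z
    constructor
    · rintro ⟨hz, s, rfl⟩
      exact ⟨s, (fermatPlane_mem_tangentBundle_iff n hm s).1 hz, rfl⟩
    · rintro ⟨s, hs, rfl⟩
      exact ⟨(fermatPlane_mem_tangentBundle_iff n hm s).2 hs, s, rfl⟩
  have hcard := (injective_fermatPlane n).encard_image {s : Fin 2 → K | ∀ i, s i ^ m = 1 / 2}
  rw [encard_pow_eq_half hm, ← hinter] at hcard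
  rw [← hcard]
  refine le_iSup_of_le _ (le_iSup_of_le ⟨0, zero_mem (LinearMap.range (fermatPlane K n))⟩
    (le_iSup_of_le ?_ (le_iSup_of_le ?_ le_rfl)))
  · rw [Submodule.toAffineSubspace_direction,
      LinearMap.finrank_range_of_inj (injective_fermatPlane n)]
    simpa using add_dimension_eq hdim
  · rw [← Set.encard_lt_top_iff, hcard, ← Nat.cast_pow]
    exact ENat.natCast_lt_top _

end Fermat

/-! ### Sharpness on the affine line -/

section Point

variable {K : Type*} [Field K]

/-- The tangent bundle of the origin is the origin of the plane, of codimension `2`, so the linear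
section is taken with the whole plane. -/
lemma one_le_geometricDegree_tangentBundle_point [IsAlgClosed K] [CharZero K] :
    1 ≤ geometricDegree (tangentBundle
      (zeroLocus K (Ideal.span {(X 0 : MvPolynomial (Fin 1) K)}))) := by
  have hX : Irreducible (X 0 : MvPolynomial (Fin 1) K) := irreducible_X 0
  have hdim : dimension (tangentBundle (zeroLocus K (Ideal.span {(X 0 : MvPolynomial (Fin 1) K)})))
      + (2 : ℕ) = ((Fintype.card (Fin 1 ⊕ Fin 1) : ℕ) : ℕ∞) := dimension_tangentBundle hX
  have hT : tangentBundle (zeroLocus K (Ideal.span {(X 0 : MvPolynomial (Fin 1) K)})) ∩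
      ((⊤ : AffineSubspace K (Fin 1 ⊕ Fin 1 → K)) : Set _) = {0} := by
    ext z
    rw [tangentBundle_eq hX, AffineSubspace.top_coe, Set.inter_univ, mem_zeroLocus_span_pair,
      aeval_differential]
    simp [_root_.funext_iff, Sum.forall]
  rw [← Set.encard_singleton (0 : Fin 1 ⊕ Fin 1 → K), ← hT]
  refine le_iSup_of_le _ (le_iSup_of_le ⟨0, AffineSubspace.mem_top _ _ _⟩
    (le_iSup_of_le ?_ (le_iSup_of_le ?_ le_rfl)))
  · rw [AffineSubspace.direction_top, finrank_top]
    simpa using add_dimension_eq hdim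
  · rw [hT]
    exact Set.finite_singleton _

end Point

end AffineVariety

end


open AffineVariety in
theorem mainTheorem7 (K : Type*) [Field K] [IsAlgClosed K] [CharZero K] :
    (∀ (n : ℕ) (V : Set (Fin n → K)),
      AffineVariety.IsIrreducibleVariety V → AffineVariety.IsHypersurface V →
      AffineVariety.IsSmoothVariety V →
        AffineVariety.geometricDegree V ≠ ⊤ ∧
        AffineVariety.geometricDegree (AffineVariety.tangentBundle V) ≤
          AffineVariety.geometricDegree V ^ 2) ∧
    (∀ n m : ℕ, 1 ≤ n → 1 ≤ m → (2 ≤ n ∨ m = 1) →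
      ∃ V : Set (Fin n → K),
        AffineVariety.IsIrreducibleVariety V ∧ AffineVariety.IsHypersurface V ∧
        AffineVariety.IsSmoothVariety V ∧
        AffineVariety.geometricDegree V = (m : ℕ∞) ∧
        AffineVariety.geometricDegree (AffineVariety.tangentBundle V) = (m : ℕ∞) ^ 2) := by
  refine ⟨fun n V hV hH _ => ?_, fun n m hn hm hnm => ?_⟩
  · obtain ⟨F, hF, rfl⟩ := exists_irreducible_of_isHypersurface hV hH
    rw [geometricDegree_hypersurface hF]
    exact ⟨ENat.natCast_ne_top _, geometricDegree_tangentBundle_le hF⟩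
  · have hm0 : m ≠ 0 := Nat.one_le_iff_ne_zero.1 hm
    obtain hn2 | rfl : 2 ≤ n ∨ n = 1 := by omega
    -- From here on `n` counts the coordinates beyond the two that occur in the Fermat equation.
    · obtain ⟨n, rfl⟩ := Nat.exists_eq_add_of_le' hn2
      have hF := irreducible_fermat (K := K) n hm0
      have hle := geometricDegree_tangentBundle_le hF
      rw [totalDegree_fermat n m] at hle
      exact ⟨zeroLocus K (Ideal.span {fermat K n m}), isIrreducibleVariety_of_irreducible hF,
        isHypersurface_of_irreducible hF, isSmoothVariety_fermat n hm0,
        by rw [geometricDegree_hypersurface hF, totalDegree_fermat n m],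
        hle.antisymm (le_geometricDegree_tangentBundle_fermat n hm0)⟩
    · obtain rfl : m = 1 := by omega
      have hF : Irreducible (X 0 : MvPolynomial (Fin 1) K) := irreducible_X 0
      have hle := geometricDegree_tangentBundle_le hF
      rw [totalDegree_X] at hle
      refine ⟨zeroLocus K (Ideal.span {X 0}), isIrreducibleVariety_of_irreducible hF,
        isHypersurface_of_irreducible hF, fun p => ?_,
        by rw [geometricDegree_hypersurface hF, totalDegree_X],
        hle.antisymm (by simpa using one_le_geometricDegree_tangentBundle_point)⟩
      refine isRegularLocalRing_of_pderiv_ne_zero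
        (vanishingIdeal_zeroLocus_of_irreducible hF) p (i₀ := 0) ?_
      simp
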